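/- Fix an integer step size $K\ge 1$. A task consists of a finite nonempty set $S$ of states, a set $S^{\mathrm{start}}\subseteq S$ of start states, a finite nonempty set $A$ of actions, a transition function $\delta$ assigning to each $(s,a)\in S\times A$ a nonempty set $\delta(s,a)\subseteq S$ of possible successors, and a reward function $R:S\times A\to\mathbb N$. A value function is a map $V:S\times A\to\mathbb N$; put $V[s]=\max_{a\in A}V(s,a)$ and $\mathrm{pref}(s,V)=\{a\in A: V(s,a)=V[s]\}$. A run of the Value-Ramp algorithm on the task is an infinite sequence $(s_i,V_i,a_i)_{i\ge 1}$ with $s_1\in S^{\mathrm{start}}$, $V_1$ an arbitrary value function, and, for every $i\geq 1$, $s_{i+1}\in\delta(s_i,a_i)$, $$V_{i+1}(s_i,a_i)=\max\bigl(0,\;V_i(s_i,a_i)+\max(V_i[s_{i+1}],R(s_i,a_i))-K-V_i[s_i]\bigr),$$ and $V_{i+1}(s,a)=V_i(s,a)$ for all $(s,a)\ne(s_i,a_i)$. The run is greedy if (1) $a_i\in\mathrm{pref}(s_i,V_i)$ for all $i$, and (2) whenever $(s_i,V_i)=(s,V)$ for infinitely many $i$, then for each $a\in\mathrm{pref}(s,V)$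 and each $s'\in\delta(s,a)$ there are infinitely many $i$ with $(s_i,V_i,a_i,s_{i+1})=(s,V,a,s')$. The task is a navigation problem with reward quantity $M$ if $R(s,a)\in\{0,M\}$ for all $(s,a)$, $R(s,a)=M$ for at least one $(s,a)$, and $M>|S|K$. For such a task let $L_1=\{s\in S:\exists a\in A,\ R(s,a)=M\}$, $L_{i}=L_{i-1}\cup\{s\in S:\exists a\in A,\ \delta(s,a)\subseteq L_{i-1}\}$ for $i\geq 2$, and $\mathrm{red}=\bigcup_{i\ge 1} L_i$. The task is reducible if $S^{\mathrm{start}}\subseteq \mathrm{red}$ and, for each $s\in S\setminus\mathrm{red}$ and each $s'\in S^{\mathrm{start}}$, there is a path $x_1,\dots,x_n$ with $x_1=s$, $x_n=s'$, $x_{i+1}\in\bigcup_{a\in A}\delta(x_i,a)$ for $1\leq i<n$, and $x_2,\dots,x_{n-1}\notin\mathrm{red}$. It is restartable if $\delta(s,a)=S^{\mathrm{start}}$ whenever $R(s,a)=M$. Theorem. For every reducible and restartable navigation problem with reward quantity $M$, and every greedy run on it with $V_1(s,a)<M$ for all $(s,a)\in S\times A$, eventually all state cycles contain reward: there is an $N$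 such that for all $j\ge N$ and $n\ge 1$ with $s_{j+n}=s_j$ there is an $i$ with $j\le i<j+n$ and $R(s_i,a_i)=M$. -/

import Mathlib

namespace ValueRamp

/-- A task on a state set `S` and an action set `A` (both finite and nonempty in the theorem):
start states, a nondeterministic transition function with nonempty successor sets,
and a reward function. -/
structure RLTask (S : Type*) (A : Type*) where
  start : Set S
  tr : S → A → Set S
  tr_nonempty : ∀ s a, (tr s a).Nonempty
  reward : S → A → ℕ

section Values

variable {S A : Type*} [Fintype A] [Nonempty A]

/-- The value of a state: the maximum of the values over the actions. -/
def stateValue (V : S → A → ℕ) (s : S) : ℕ :=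
  Finset.univ.sup' Finset.univ_nonempty (fun a => V s a)

/-- The actions preferred by the state `s` in the value function `V`. -/
def pref (V : S → A → ℕ) (s : S) : Set A :=
  {a | V s a = stateValue V s}

/-- The learning rule `max (v', r) - K - v`, an integer. -/
def learningRule (K v v' r : ℕ) : ℤ :=
  max (v' : ℤ) (r : ℤ) - (K : ℤ) - (v : ℤ)

open Classical in
/-- The value function after performing `a` in `s` and observing the successor `s'`.
`Int.toNat` replaces negative integers by `0`. The value of `s'` is taken in the old `V`. -/
noncomputable def updateValue (K : ℕ) (T : RLTask S A) (V : S → A → ℕ) (s : S) (a : A) (s' : S) :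
    S → A → ℕ :=
  fun t b =>
    if t = s ∧ b = a then
      Int.toNat ((V s a : ℤ)
        + learningRule K (stateValue V s) (stateValue V s') (T.reward s a))
    else V t b

/-- A run: the infinite sequence of transitions
`(state i, value i) → (state (i + 1), value (i + 1))` through the action `action i`,
beginning in a start state, with an arbitrary initial value function. -/
structure Run (K : ℕ) (T : RLTask S A) where
  state : ℕ → S
  action : ℕ → A
  value : ℕ → S → A → ℕ
  state_zero : state 0 ∈ T.start
  state_succ : ∀ i, state (i + 1) ∈ T.tr (state i) (action i)
  value_succ : ∀ i,
    value (i + 1) = updateValue K T (value i) (state i) (action i) (state (i + 1))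

/-- A run is greedy if it always performs a preferred action and if, for every configuration
`(s, V)` that occurs infinitely often, every preferred action of `s` in `V` is performed
infinitely often in this configuration with every one of its possible successors. -/
structure Run.IsGreedy {K : ℕ} {T : RLTask S A} (ρ : Run K T) : Prop where
  action_mem_pref : ∀ i, ρ.action i ∈ pref (ρ.value i) (ρ.state i)
  fair : ∀ (s : S) (V : S → A → ℕ),
    (∃ᶠ i in Filter.atTop, ρ.state i = s ∧ ρ.value i = V) →
    ∀ a ∈ pref V s, ∀ s' ∈ T.tr s a,
      ∃ᶠ i in Filter.atTop,
        ρ.state i = s ∧ ρ.value i = V ∧ ρ.action i = a ∧ ρ.state (i + 1) = s'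

end Values

section Tasks

variable {S A : Type*}

/-- A navigation problem with reward quantity `M`: all rewards are `0` or `M`, the reward `M`
occurs, and `M > |S| K`, so that in particular `M` is nonzero. -/
structure RLTask.IsNavigation [Fintype S] (T : RLTask S A) (K M : ℕ) : Prop where
  reward_eq : ∀ s a, T.reward s a = M ∨ T.reward s a = 0
  exists_reward : ∃ s a, T.reward s a = M
  large : Fintype.card S * K < M

/-- The state-action pairs with reward `M`. -/
def RLTask.rewards (T : RLTask S A) (M : ℕ) : Set (S × A) :=
  {p | T.reward p.1 p.2 = M}

/-- The states in which immediate reward can be obtained. -/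
def RLTask.goals (T : RLTask S A) (M : ℕ) : Set S :=
  {s | ∃ a, (s, a) ∈ T.rewards M}

/-- The layers of reducible states; the layers are numbered from `0`. -/
def RLTask.reduceLayer (T : RLTask S A) (M : ℕ) : ℕ → Set S
  | 0 => T.goals M
  | i + 1 => T.reduceLayer M i ∪ {s | ∃ a, T.tr s a ⊆ T.reduceLayer M i}

/-- The reducible states. -/
def RLTask.reduce (T : RLTask S A) (M : ℕ) : Set S :=
  ⋃ i, T.reduceLayer M i

/-- A task is reducible if all start states are reducible and, from every non-reducible state `s`
to every start state `s'`, there is a path `x 0, …, x n` whose states strictly between the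
two ends are all non-reducible. -/
structure RLTask.IsReducible (T : RLTask S A) (M : ℕ) : Prop where
  start_subset : T.start ⊆ T.reduce M
  escape : ∀ s, s ∉ T.reduce M → ∀ s' ∈ T.start,
    ∃ (n : ℕ) (x : ℕ → S), x 0 = s ∧ x n = s' ∧
      (∀ i < n, ∃ a, x (i + 1) ∈ T.tr (x i) a) ∧
      (∀ i, 0 < i → i < n → x i ∉ T.reduce M)

/-- A task is restartable if the successors of a rewarding pair are exactly the start states. -/
def RLTask.IsRestartable (T : RLTask S A) (M : ℕ) : Prop :=
  ∀ s a, (s, a) ∈ T.rewards M → T.tr s a = T.start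

end Tasks

end ValueRamp

/-!
For a greedy action the old value cancels in the learning rule: the value of the performed pair
becomes `max (V[s'], R) - K`, truncated at `0`. So all values stay below `M`, and there are only
finitely many configurations `(s, V)`. Let `C` be the set of those that occur infinitely often;
eventually the run stays in `C`, and by fairness `C` is closed under all greedy steps.

*Layers.* Call a state learned at level `i` if it has an action of value at least `M - i * K` that
is rewarded or leads surely to states learned at level `i - 1` (`learned`). Greedy steps preserve
this (`learned_subset_updateValue`), so the levels are constant on `C` and define a rank `r`
there (`Run.exists_isRanked`). Since `M > |S| * K`, learned states have positive values. An action
of a learned state `s` whose value falls below `M - r s * K` is never preferred again; the other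
actions, again the same ones throughout `C`, are the live ones. A preferred unrewarded action
always has an outcome of rank at least `r s - 1`, as the state would otherwise have smaller rank.

*Pessimistic outcomes.* As the run visits all of `C` again and again, any choice of outcomes may
be imposed when a contradiction is sought. This is expressed by minimal nonempty subsets `B` of `C`
closed under rewarded greedy steps and under admitted unrewarded ones. The main tool is the bound
`IsMinClosed.stateValue_le`: if `f` grows by at most `K` along these steps and is at least `M - K`
where reward is obtained, then `V[s] ≤ f s` on `B`.
With `f = 0` it shows that `B` contains reward, hence all start states, by reducibility and
restartability (`IsRanked.exists_reward`); in particular all start states are learned.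
With `f = M - min r R * K`, for steps on which `min r R` drops by at most one, it shows for
`R = r x + 1` that all live actions of a learned state `x` visited by `B` have the same value
`M - r x * K`, are therefore preferred, and lead only to smaller ranks or reward
(`IsRanked.mem_pref_and_rank_lt`). By induction along live actions from the start states, these sets
`B` visit every state so reached (`IsRanked.visits_of_liveReachable`).

Hence, once the run in `C` has passed a start state, every unrewarded step lowers the rank, and
a cycle of states must contain reward.
-/

namespace ValueRamp

open Filter

/-! ### Greedy updates -/

section Update

variable {S A : Type*} [Fintype A] [Nonempty A]

lemma le_stateValue (V : S → A → ℕ) (s : S) (a : A) : V s a ≤ stateValue V s :=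
  Finset.le_sup' (fun a => V s a) (Finset.mem_univ a)

lemma stateValue_le {V : S → A → ℕ} {s : S} {n : ℕ} (h : ∀ a, V s a ≤ n) :
    stateValue V s ≤ n :=
  Finset.sup'_le _ _ fun a _ => h a

lemma exists_mem_pref (V : S → A → ℕ) (s : S) : ∃ a, a ∈ pref V s := by
  obtain ⟨a, -, ha⟩ := Finset.exists_mem_eq_sup' Finset.univ_nonempty (fun a => V s a)
  exact ⟨a, ha.symm⟩

lemma stateValue_lt {V : S → A → ℕ} {s : S} {n : ℕ} (h : ∀ a, V s a < n) :
    stateValue V s < n := by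
  obtain ⟨a, ha⟩ := exists_mem_pref V s
  exact ha ▸ h a

lemma stateValue_congr {V W : S → A → ℕ} {s : S} (h : ∀ a, V s a = W s a) :
    stateValue V s = stateValue W s :=
  le_antisymm (stateValue_le fun a => h a ▸ le_stateValue W s a)
    (stateValue_le fun a => (h a).symm ▸ le_stateValue V s a)

/-- For a preferred action the old value cancels in the learning rule. -/
lemma updateValue_self {K : ℕ} {T : RLTask S A} {V : S → A → ℕ} {s : S} {a : A} (s' : S)
    (ha : a ∈ pref V s) :
    updateValue K T V s a s' s a = max (stateValue V s') (T.reward s a) - K := by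
  have h : V s a = stateValue V s := ha
  simp only [updateValue, learningRule, and_self, if_true]
  omega

lemma updateValue_of_ne {K : ℕ} {T : RLTask S A} {V : S → A → ℕ} {s t : S} {a b : A} (s' : S)
    (h : ¬ (t = s ∧ b = a)) : updateValue K T V s a s' t b = V t b := by
  simp only [updateValue, if_neg h]

/-- With all values below `M`, a rewarded preferred action gets the value `M - K`. -/
lemma updateValue_reward {K M : ℕ} {T : RLTask S A} {V : S → A → ℕ} {s : S} {a : A} (s' : S)
    (ha : a ∈ pref V s) (hV : ∀ t b, V t b < M) (hr : T.reward s a = M) :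
    updateValue K T V s a s' s a = M - K := by
  rw [updateValue_self s' ha, hr, max_eq_right (stateValue_lt (hV s')).le]

lemma updateValue_lt {K M : ℕ} {T : RLTask S A} {V : S → A → ℕ} {s : S} {a : A} (s' : S)
    (hK : 1 ≤ K) (hM : 0 < M) (hr : ∀ s a, T.reward s a ≤ M)
    (ha : a ∈ pref V s) (hV : ∀ t b, V t b < M) (t : S) (b : A) :
    updateValue K T V s a s' t b < M := by
  by_cases h : t = s ∧ b = a
  · obtain ⟨rfl, rfl⟩ := h
    rw [updateValue_self s' ha]
    have := stateValue_lt (hV s')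
    have := hr t b
    omega
  · rw [updateValue_of_ne s' h]
    exact hV t b

end Update

/-! ### Learned layers -/

section Learned

variable {S A : Type*}

/-- The layers of states that have learned, in the value function `V`, a guaranteed way to
reward: a state of layer `i + 1` has an action of value at least `M - (i + 1) * K` that is
rewarded or leads surely to layer `i`. The inequality is written without subtraction. -/
def learned (T : RLTask S A) (K M : ℕ) (V : S → A → ℕ) : ℕ → Set S
  | 0 => ∅
  | i + 1 => {s | ∃ a, M ≤ V s a + (i + 1) * K ∧
      (T.reward s a = M ∨ T.tr s a ⊆ learned T K M V i)}

lemma learned_subset_succ (T : RLTask S A) (K M : ℕ) (V : S → A → ℕ) (i : ℕ) :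
    learned T K M V i ⊆ learned T K M V (i + 1) := by
  induction i with
  | zero => exact Set.empty_subset _
  | succ i ih =>
    rintro s ⟨a, h, h'⟩
    refine ⟨a, h.trans ?_, h'.imp id fun h' => h'.trans ih⟩
    gcongr
    omega

lemma learned_subset_reduce (T : RLTask S A) (K M : ℕ) (V : S → A → ℕ) (i : ℕ) :
    learned T K M V i ⊆ T.reduce M := by
  have key : ∀ i, learned T K M V (i + 1) ⊆ T.reduceLayer M i := by
    intro i
    induction i with
    | zero =>
      rintro s ⟨a, -, h | h⟩
      · exact ⟨a, h⟩
      · obtain ⟨x, hx⟩ := T.tr_nonempty s a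
        exact (h hx).elim
    | succ i ih =>
      rintro s ⟨a, -, h | h⟩
      · have : ∀ j, s ∈ T.reduceLayer M j := by
          intro j
          induction j with
          | zero => exact ⟨a, h⟩
          | succ j ih => exact Or.inl ih
        exact this _
      · exact Or.inr ⟨a, h.trans ih⟩
  exact ((learned_subset_succ T K M V i).trans (key i)).trans
    (Set.subset_iUnion (T.reduceLayer M) i)

variable [Fintype A] [Nonempty A]

lemma le_stateValue_of_mem_learned {T : RLTask S A} {K M : ℕ} {V : S → A → ℕ} {i : ℕ} {s : S}
    (h : s ∈ learned T K M V i) : M ≤ stateValue V s + i * K := by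
  cases i with
  | zero => exact h.elim
  | succ i =>
    obtain ⟨a, ha, -⟩ := h
    have := le_stateValue V s a
    omega

/-- After a step into layer `i` the performed action has the value that layer `i + 1` requires. -/
lemma le_updateValue_of_mem_learned {T : RLTask S A} {K M : ℕ} {V : S → A → ℕ} {i : ℕ}
    {s s' : S} {a : A} (ha : a ∈ pref V s) (hs' : s' ∈ learned T K M V i) :
    M ≤ updateValue K T V s a s' s a + (i + 1) * K := by
  have := le_stateValue_of_mem_learned hs'
  rw [updateValue_self s' ha, add_one_mul]
  omega

/-- What has been learned is never lost by greedy steps. -/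
lemma learned_subset_updateValue {T : RLTask S A} {K M : ℕ} {V : S → A → ℕ} {s s' : S} {a : A}
    (ha : a ∈ pref V s) (hs' : s' ∈ T.tr s a) (hV : ∀ t b, V t b < M) (i : ℕ) :
    learned T K M V i ⊆ learned T K M (updateValue K T V s a s') i := by
  induction i with
  | zero => exact subset_rfl
  | succ i ih =>
    rintro t ⟨b, hb, h⟩
    refine ⟨b, ?_, h.imp id fun h => h.trans ih⟩
    by_cases e : t = s ∧ b = a
    · obtain ⟨rfl, rfl⟩ := e
      rcases h with h | h
      · rw [updateValue_reward s' ha hV h, add_one_mul]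
        omega
      · exact le_updateValue_of_mem_learned ha (h hs')
    · rwa [updateValue_of_ne s' e]

end Learned

/-! ### Ranks from increasing sequences of sets -/

/-- An increasing sequence of subsets of a finite type has a first stationary index `h`; the rank is the index of first membership in the sequence, or `h + 1` for
the elements that are not in the `h`-th set. No rank exceeds the number of elements. -/
lemma exists_rank {S : Type*} [Fintype S] (D : ℕ → Set S)
    (hD : ∀ i, D i ⊆ D (i + 1)) :
    ∃ (h : ℕ) (r : S → ℕ), D (h + 1) = D h ∧ (∀ s, r s ≤ h + 1) ∧
      (∀ s, r s ≤ Fintype.card S) ∧ ∀ s, ∀ i ≤ h, r s ≤ i ↔ s ∈ D i := by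
  classical
  have hmono : Monotone D := monotone_nat_of_le_succ hD
  have hstab : ∃ i, D (i + 1) = D i := by
    by_contra! hne
    have hlt : ∀ i, (D i).ncard < (D (i + 1)).ncard := fun i =>
      Set.ncard_lt_ncard ((hD i).ssubset_of_ne (hne i).symm)
    have := (strictMono_nat_of_lt_succ hlt).le_apply (x := Fintype.card S + 1)
    have h2 := Set.ncard_le_card (D (Fintype.card S + 1))
    rw [Nat.card_eq_fintype_card] at h2
    omega
  let h := Nat.find hstab
  have hcard : ∀ i ≤ h, i ≤ (D i).ncard := by
    intro i
    induction i with
    | zero => intro _; exact Nat.zero_le _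
    | succ i ih =>
      intro hi
      have h1 := ih (by omega)
      have h2 : D (i + 1) ≠ D i := Nat.find_min hstab (show i < h by omega)
      have := Set.ncard_lt_ncard ((hD i).ssubset_of_ne h2.symm)
      omega
  have hex : ∀ s, ∃ i, s ∈ D i ∨ i = h + 1 := fun s => ⟨h + 1, Or.inr rfl⟩
  have hle : ∀ s, Nat.find (hex s) ≤ h + 1 := fun s => Nat.find_min' (hex s) (Or.inr rfl)
  have hiff : ∀ s, ∀ i ≤ h, Nat.find (hex s) ≤ i ↔ s ∈ D i := by
    intro s i hi
    refine ⟨fun hs => ?_, fun hs => Nat.find_min' (hex s) (Or.inl hs)⟩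
    rcases Nat.find_spec (hex s) with h1 | h1
    · exact hmono hs h1
    · omega
  refine ⟨h, fun s => Nat.find (hex s), Nat.find_spec hstab, hle, fun s => ?_, hiff⟩
  show Nat.find (hex s) ≤ Fintype.card S
  by_cases hs : s ∈ D h
  · have h1 := (hiff s h le_rfl).2 hs
    have h2 := Set.ncard_le_card (D h)
    rw [Nat.card_eq_fintype_card] at h2
    have := hcard h le_rfl
    omega
  · have h1 : (D h).ncard < (Set.univ : Set S).ncard :=
      Set.ncard_lt_ncard ((Set.subset_univ _).ssubset_of_ne fun e => hs (e ▸ Set.mem_univ s))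
    rw [Set.ncard_univ, Nat.card_eq_fintype_card] at h1
    have := hcard h le_rfl
    have := hle s
    omega

/-! ### Closed sets of configurations -/

section Closed

variable {S A : Type*} [Fintype A] [Nonempty A]

/-- A set of configurations (state, value function) that contains with a configuration all its
successors under rewarded greedy transitions and under those unrewarded greedy transitions
whose states are related by `adm`. -/
def StepClosed (T : RLTask S A) (K M : ℕ) (adm : S → S → Prop)
    (B : Set (S × (S → A → ℕ))) : Prop :=
  ∀ s V, (s, V) ∈ B → ∀ a ∈ pref V s, ∀ s' ∈ T.tr s a, (T.reward s a = M ∨ adm s s') →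
    (s', updateValue K T V s a s') ∈ B

/-- The minimal ones among the nonempty closed subsets of `C`. -/
def IsMinClosed (T : RLTask S A) (K M : ℕ) (adm : S → S → Prop)
    (C B : Set (S × (S → A → ℕ))) : Prop :=
  Minimal (fun B => B.Nonempty ∧ B ⊆ C ∧ StepClosed T K M adm B) B

variable {T : RLTask S A} {K M : ℕ} {adm adm' : S → S → Prop} {B C : Set (S × (S → A → ℕ))}

lemma IsMinClosed.nonempty (h : IsMinClosed T K M adm C B) : B.Nonempty := h.prop.1

lemma IsMinClosed.subset (h : IsMinClosed T K M adm C B) : B ⊆ C := h.prop.2.1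

lemma IsMinClosed.closed (h : IsMinClosed T K M adm C B) : StepClosed T K M adm B := h.prop.2.2

lemma IsMinClosed.subset_of_closed (h : IsMinClosed T K M adm C B) {B' : Set (S × (S → A → ℕ))}
    (hB' : B' ⊆ B) (hne : B'.Nonempty) (hcl : StepClosed T K M adm B') : B ⊆ B' :=
  h.le_of_le ⟨hne, hB'.trans h.subset, hcl⟩ hB'

lemma StepClosed.mono (h : StepClosed T K M adm B) (hadm : ∀ s s', adm' s s' → adm s s') :
    StepClosed T K M adm' B :=
  fun s V hs a ha s' hs' h' => h s V hs a ha s' hs' (h'.imp id (hadm s s'))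

lemma StepClosed.exists_isMinClosed (h : StepClosed T K M adm B) (hC : C.Finite)
    (hne : B.Nonempty) (hBC : B ⊆ C) : ∃ B' ⊆ B, IsMinClosed T K M adm C B' := by
  have hfin : {B : Set (S × (S → A → ℕ)) | B.Nonempty ∧ B ⊆ C ∧ StepClosed T K M adm B}.Finite :=
    hC.finite_subsets.subset fun B hB => hB.2.1
  exact hfin.exists_le_minimal ⟨hne, hBC, h⟩

/-- The learning rule looks at the value of `s'` before the update at `s`. For `s' ≠ s` it
equals the one after the update; for `s' = s` the configuration before the step is in `B`. -/
lemma StepClosed.exists_stateValue_eq (h : StepClosed T K M adm B) {s : S} {V : S → A → ℕ}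
    (hs : (s, V) ∈ B) {a : A} (ha : a ∈ pref V s) {s' : S} (hs' : s' ∈ T.tr s a)
    (h' : T.reward s a = M ∨ adm s s') :
    ∃ W, (s', W) ∈ B ∧ stateValue W s' = stateValue V s' := by
  by_cases e : s' = s
  · subst e
    exact ⟨V, hs, rfl⟩
  · exact ⟨_, h s V hs a ha s' hs' h',
      stateValue_congr fun b => updateValue_of_ne s' fun hb => e hb.1⟩

/-- The values in a minimal closed set are bounded by every function `f` that increases by
at most `K` along the admitted unrewarded steps and is at least `M - K` at rewarded ones.
Otherwise, consider the states of maximal excess over `f`, and among them one of maximal `f`: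
whenever its preferred action is performed, the excess of that pair becomes smaller and cannot
recover, so that the smaller values form a smaller closed set. -/
lemma IsMinClosed.stateValue_le (h : IsMinClosed T K M adm C B) (hK : 1 ≤ K) (hC : C.Finite)
    (hCM : ∀ c ∈ C, ∀ t b, c.2 t b < M) (hT : ∀ s a, T.reward s a = M ∨ T.reward s a = 0)
    (f : S → ℕ)
    (hprog : ∀ s V, (s, V) ∈ B → ∀ a ∈ pref V s, T.reward s a ≠ M → ∃ s' ∈ T.tr s a, adm s s')
    (hrew : ∀ s V, (s, V) ∈ B → ∀ a ∈ pref V s, T.reward s a = M → M - K ≤ f s)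
    (hf : ∀ s V, (s, V) ∈ B → ∀ a ∈ pref V s, ∀ s' ∈ T.tr s a, adm s s' → f s' ≤ f s + K)
    {s : S} {V : S → A → ℕ} (hs : (s, V) ∈ B) : stateValue V s ≤ f s := by
  by_contra! hlt
  have hBfin : B.Finite := hC.subset h.subset
  let e : S × (S → A → ℕ) → ℕ := fun c => stateValue c.2 c.1 - f c.1
  obtain ⟨c₀, hc₀, hmax⟩ := Set.exists_max_image B e hBfin h.nonempty
  have hm : 0 < e c₀ := by
    have h1 : e (s, V) ≤ e c₀ := hmax _ hs
    have h2 : 0 < e (s, V) := Nat.sub_pos_of_lt hlt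
    omega
  obtain ⟨⟨x, W⟩, ⟨hxB, hxe⟩, hxmax⟩ := Set.exists_max_image {c ∈ B | e c = e c₀}
    (fun c => f c.1) (hBfin.subset (Set.sep_subset _ _)) ⟨c₀, hc₀, rfl⟩
  have hxW : stateValue W x = f x + e c₀ := by
    have : stateValue W x - f x = e c₀ := hxe
    omega
  obtain ⟨a, ha⟩ := exists_mem_pref W x
  have key : ∀ U, (x, U) ∈ B → a ∈ pref U x → ∀ s' ∈ T.tr x a, (T.reward x a = M ∨ adm x s') →
      updateValue K T U x a s' x a < f x + e c₀ := by
    intro U hU haU s' hs' hadm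
    by_cases hr : T.reward x a = M
    · rw [updateValue_reward s' haU (hCM _ (h.subset hU)) hr]
      have := hrew x U hU a haU hr
      omega
    · have hadm' := hadm.resolve_left hr
      rw [updateValue_self s' haU, (hT x a).resolve_left hr, max_eq_left (Nat.zero_le _)]
      have h1 := hf x U hU a haU s' hs' hadm'
      obtain ⟨U', hU', hv⟩ := h.closed.exists_stateValue_eq hU haU hs' hadm
      have h2 : stateValue U' s' - f s' ≤ e c₀ := hmax _ hU'
      rcases h1.lt_or_eq with h3 | h3
      · omega
      · have h4 : stateValue U' s' - f s' ≠ e c₀ := fun h4 => by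
          have : f s' ≤ f x := hxmax (s', U') ⟨hU', h4⟩
          omega
        omega
  have hsub : B ⊆ {c ∈ B | c.2 x a < f x + e c₀} := by
    refine h.subset_of_closed (Set.sep_subset _ _) ?_ ?_
    · obtain ⟨s', hs', hadm⟩ : ∃ s' ∈ T.tr x a, (T.reward x a = M ∨ adm x s') := by
        by_cases hr : T.reward x a = M
        · exact (T.tr_nonempty x a).imp fun s' hs' => ⟨hs', Or.inl hr⟩
        · exact (hprog x W hxB a ha hr).imp fun s' hs' => ⟨hs'.1, Or.inr hs'.2⟩
      exact ⟨_, h.closed x W hxB a ha s' hs' hadm, key W hxB ha s' hs' hadm⟩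
    · rintro t U ⟨hU, hUlt⟩ b hb s' hs' hadm
      refine ⟨h.closed t U hU b hb s' hs' hadm, ?_⟩
      by_cases he : x = t ∧ a = b
      · obtain ⟨rfl, rfl⟩ := he
        exact key U hU hb s' hs' hadm
      · show updateValue K T U t b s' x a < f x + e c₀
        rw [updateValue_of_ne s' he]
        exact hUlt
  have h1 : W x a < f x + e c₀ := (hsub hxB).2
  have h2 : W x a = stateValue W x := ha
  omega

end Closed

/-! ### Recurrent configurations with a rank function -/

section Ranked

variable {S A : Type*} [Fintype A] [Nonempty A]

/-- The properties of a finite set `C` of configurations, closed under greedy steps, on which the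
learned layers are constant: `r` is the rank of a state with respect to these layers, the
first `h` of which are distinct, and `r s = h + 1` means that `s` is not learned. -/
structure IsRanked (T : RLTask S A) (K M : ℕ) (C : Set (S × (S → A → ℕ))) (r : S → ℕ) (h : ℕ) :
    Prop where
  finite : C.Finite
  nonempty : C.Nonempty
  closed : StepClosed T K M (fun _ _ => True) C
  value_lt : ∀ c ∈ C, ∀ t b, c.2 t b < M
  rank_pos : ∀ s, 0 < r s
  rank_le : ∀ s, r s ≤ h + 1
  rank_mul_lt : ∀ s, r s * K < M
  rank_of_reward : ∀ s V, (s, V) ∈ C → ∀ a ∈ pref V s, T.reward s a = M → r s = 1 ∧ r s ≤ h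
  rank_of_tr : ∀ s V, (s, V) ∈ C → ∀ a ∈ pref V s, ∀ i ≤ h, (∀ s' ∈ T.tr s a, r s' ≤ i) →
    r s ≤ i + 1 ∧ r s ≤ h
  le_stateValue : ∀ c ∈ C, ∀ t, r t ≤ h → M ≤ stateValue c.2 t + r t * K
  live_of_live : ∀ c ∈ C, ∀ c' ∈ C, ∀ t b, r t ≤ h → M ≤ c.2 t b + r t * K →
    M ≤ c'.2 t b + r t * K
  mem_reduce : ∀ s, r s ≤ h → s ∈ T.reduce M

variable {T : RLTask S A} {K M : ℕ} {adm : S → S → Prop} {B C : Set (S × (S → A → ℕ))}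
  {r : S → ℕ} {h : ℕ}

/-- A minimal closed set admits reward. Otherwise all values in it are `0`, so that its states
are not learned and all their actions are preferred. As steps to other states that are not
learned are admitted, it contains no reducible state, and can be left for a start state. -/
lemma IsRanked.exists_reward (hR : IsRanked T K M C r h) (hB : IsMinClosed T K M adm C B)
    (hK : 1 ≤ K) (hT : ∀ s a, T.reward s a = M ∨ T.reward s a = 0) (hred : T.IsReducible M)
    (hprog : ∀ s V, (s, V) ∈ B → ∀ a ∈ pref V s, T.reward s a ≠ M → ∃ s' ∈ T.tr s a, adm s s')
    (hout : ∀ s s', r s' = h + 1 → adm s s')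
    {x : S} (hx : x ∈ T.start) (hxadm : ∀ s, r s = h + 1 → adm s x) :
    ∃ s V a, (s, V) ∈ B ∧ a ∈ pref V s ∧ T.reward s a = M := by
  by_contra! hno
  have hzero : ∀ s V, (s, V) ∈ B → stateValue V s = 0 := fun s V hs => by
    have := hB.stateValue_le hK hR.finite hR.value_lt hT (fun _ => 0) hprog
      (fun s V hs a ha hr => (hno s V a hs ha hr).elim) (fun _ _ _ _ _ _ _ _ => Nat.zero_le _) hs
    omega
  have hpref : ∀ s V, (s, V) ∈ B → ∀ a, a ∈ pref V s := fun s V hs a => by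
    have h1 := hzero s V hs
    have h2 := ValueRamp.le_stateValue V s a
    show V s a = stateValue V s
    omega
  have hrank : ∀ s V, (s, V) ∈ B → r s = h + 1 := fun s V hs => by
    by_contra hne
    have h1 := hR.le_stateValue _ (hB.subset hs) s (by have := hR.rank_le s; omega)
    have h2 : stateValue V s = 0 := hzero s V hs
    have h3 := hR.rank_mul_lt s
    simp only [h2] at h1
    omega
  have hlayer : ∀ i s V, (s, V) ∈ B → s ∉ T.reduceLayer M i := by
    intro i
    induction i with
    | zero =>
      rintro s V hs ⟨a, ha⟩
      exact hno s V a hs (hpref s V hs a) ha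
    | succ i ih =>
      rintro s V hs (hs' | ⟨a, ha⟩)
      · exact ih s V hs hs'
      · obtain ⟨s', hs', hr⟩ : ∃ s' ∈ T.tr s a, r s' = h + 1 := by
          by_contra! hall
          have h1 := hR.rank_of_tr s V (hB.subset hs) a (hpref s V hs a) h le_rfl fun s' hs' => by
            have := hR.rank_le s'
            have := hall s' hs'
            omega
          have := hrank s V hs
          omega
        exact ih s' _ (hB.closed s V hs a (hpref s V hs a) s' hs' (Or.inr (hout s s' hr))) (ha hs')
  have hnot : ∀ s V, (s, V) ∈ B → s ∉ T.reduce M := fun s V hs hs' => by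
    obtain ⟨i, hi⟩ := Set.mem_iUnion.1 hs'
    exact hlayer i s V hs hi
  obtain ⟨⟨z, W⟩, hz⟩ := hB.nonempty
  obtain ⟨n, p, hp0, hpn, hstep, hp⟩ := hred.escape z (hnot z W hz) x hx
  have hpath : ∀ i ≤ n, ∃ V, (p i, V) ∈ B := by
    intro i
    induction i with
    | zero => exact fun _ => ⟨W, hp0 ▸ hz⟩
    | succ i ih =>
      intro hi
      obtain ⟨V, hV⟩ := ih (by omega)
      obtain ⟨a, ha⟩ := hstep i (by omega)
      refine ⟨_, hB.closed _ V hV a (hpref _ V hV a) _ ha (Or.inr ?_)⟩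
      rcases hi.lt_or_eq with hlt | heq
      · refine hout _ _ ?_
        by_contra hne
        exact hp (i + 1) (by omega) hlt
          (hR.mem_reduce _ (by have := hR.rank_le (p (i + 1)); omega))
      · rw [heq, hpn]
        exact hxadm _ (hrank _ V hV)
  obtain ⟨V, hV⟩ := hpath n le_rfl
  exact hnot _ V hV (hpn ▸ hred.start_subset hx)

/-- All start states are learned: otherwise the configurations of states that are not learned
would be closed under steps among such states, without reward. -/
lemma IsRanked.rank_le_of_mem_start (hR : IsRanked T K M C r h) (hK : 1 ≤ K)
    (hT : ∀ s a, T.reward s a = M ∨ T.reward s a = 0) (hred : T.IsReducible M)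
    (hres : T.IsRestartable M) {x : S} (hx : x ∈ T.start) : r x ≤ h := by
  by_contra hlt
  have hrx : r x = h + 1 := by have := hR.rank_le x; omega
  obtain ⟨B, -, hB⟩ := (hR.closed.mono (adm' := fun s s' => r s = h + 1 → r s' = h + 1)
    fun _ _ _ => trivial).exists_isMinClosed hR.finite hR.nonempty subset_rfl
  obtain ⟨s, V, a, hs, ha, hr⟩ := hR.exists_reward hB hK hT hred (fun s V hs a ha _ => by
      by_contra! hno
      have h1 := hR.rank_of_tr s V (hB.subset hs) a ha h le_rfl fun s' hs' => by
        have := hR.rank_le s'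
        have := (hno s' hs').2
        omega
      obtain ⟨s', hs'⟩ := T.tr_nonempty s a
      have := (hno s' hs').1
      omega) (fun _ _ h _ => h) hx (fun _ _ _ => hrx)
  have hxs : x ∈ T.tr s a := by
    rw [hres s a hr]
    exact hx
  have hsub : B ⊆ {c ∈ B | r c.1 = h + 1} := by
    refine hB.subset_of_closed (Set.sep_subset _ _)
      ⟨_, hB.closed s V hs a ha x hxs (Or.inl hr), hrx⟩ ?_
    rintro t W ⟨ht, hrt⟩ b hb s' hs' hadm
    refine ⟨hB.closed t W ht b hb s' hs' hadm, ?_⟩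
    rcases hadm with hadm | hadm
    · have h1 := (hR.rank_of_reward t W (hB.subset ht) b hb hadm).2
      have h2 : r t = h + 1 := hrt
      omega
    · exact hadm hrt
  have h1 := (hR.rank_of_reward s V (hB.subset hs) a ha hr).2
  have h2 : r s = h + 1 := (hsub hs).2
  omega

/-- The relation that admits a step if the rank, capped at `R`, decreases by at most one. -/
def SlowDescent (r : S → ℕ) (R : ℕ) (s s' : S) : Prop :=
  min (r s) R ≤ min (r s') R + 1

/-- Every preferred action without reward has an outcome of slow descent, as otherwise the rank
of the state would be smaller. -/
lemma IsRanked.exists_slowDescent (hR : IsRanked T K M C r h) (R : ℕ) {s : S} {V : S → A → ℕ}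
    (hs : (s, V) ∈ C) {a : A} (ha : a ∈ pref V s) : ∃ s' ∈ T.tr s a, SlowDescent r R s s' := by
  by_contra! hno
  have hlt : ∀ s' ∈ T.tr s a, r s' + 2 ≤ r s := fun s' hs' => by
    have := hno s' hs'
    unfold SlowDescent at this
    omega
  obtain ⟨s', hs'⟩ := T.tr_nonempty s a
  have h1 := hlt s' hs'
  have h2 := hR.rank_le s
  have h3 := hR.rank_of_tr s V hs a ha (r s - 2) (by omega) fun s' hs' => by
    have := hlt s' hs'
    omega
  omega

/-- Under slow descent the values sink to those that the capped ranks promise. -/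
lemma IsRanked.stateValue_le_of_slowDescent (hR : IsRanked T K M C r h) {R : ℕ} (hR1 : 1 ≤ R)
    (hB : IsMinClosed T K M (SlowDescent r R) C B) (hK : 1 ≤ K)
    (hT : ∀ s a, T.reward s a = M ∨ T.reward s a = 0) {s : S} {V : S → A → ℕ}
    (hs : (s, V) ∈ B) : stateValue V s ≤ M - min (r s) R * K := by
  refine hB.stateValue_le hK hR.finite hR.value_lt hT (fun s => M - min (r s) R * K) ?_ ?_ ?_ hs
  · intro s V hs a ha _
    exact hR.exists_slowDescent R (hB.subset hs) ha
  · intro s V hs a ha hr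
    rw [(hR.rank_of_reward s V (hB.subset hs) a ha hr).1, min_eq_left hR1, one_mul]
  · intro s V _ a _ s' _ hadm
    have h1 := Nat.mul_le_mul_right K hadm
    rw [add_one_mul] at h1
    show M - min (r s') R * K ≤ M - min (r s) R * K + K
    omega

/-- If a minimal closed set for the cap `r x + 1` visits `x`, all live actions of `x` have the same
value there. Hence they are all preferred, and without reward their outcomes have smaller rank:
another outcome would push the value below the promised one, and the action would no longer be live. -/
lemma IsRanked.mem_pref_and_rank_lt (hR : IsRanked T K M C r h) {x : S}
    (hB : IsMinClosed T K M (SlowDescent r (r x + 1)) C B) (hK : 1 ≤ K)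
    (hT : ∀ s a, T.reward s a = M ∨ T.reward s a = 0) (hrx : r x ≤ h) {V : S → A → ℕ}
    (hs : (x, V) ∈ B) {a : A} (hlive : M ≤ V x a + r x * K) :
    a ∈ pref V x ∧ (T.reward x a ≠ M → ∀ s' ∈ T.tr x a, r s' < r x) := by
  have hbound := fun {s V} => hR.stateValue_le_of_slowDescent (s := s) (V := V)
    (Nat.le_add_left 1 (r x)) hB hK hT
  have hpos := hR.rank_mul_lt x
  have ha : a ∈ pref V x := by
    have h1 := hbound hs
    rw [min_eq_left (Nat.le_succ _)] at h1
    have h2 := ValueRamp.le_stateValue V x a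
    show V x a = stateValue V x
    omega
  refine ⟨ha, fun hr s' hs' => ?_⟩
  by_contra! hle
  have hadm : SlowDescent r (r x + 1) x s' := by
    unfold SlowDescent
    omega
  have hstep := hB.closed x V hs a ha s' hs' (Or.inr hadm)
  have h1 : M ≤ updateValue K T V x a s' x a + r x * K :=
    hR.live_of_live _ (hB.subset hs) _ (hB.subset hstep) x a hrx hlive
  rw [updateValue_self s' ha, (hT x a).resolve_left hr, max_eq_left (Nat.zero_le _)] at h1
  obtain ⟨W, hW, hv⟩ := hB.closed.exists_stateValue_eq hs ha hs' (Or.inr hadm)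
  have h2 := hbound hW
  have h3 : r x * K ≤ min (r s') (r x + 1) * K := Nat.mul_le_mul_right K (by omega)
  omega

/-- The states reachable from the start states by live actions without reward. A live action of a
learned state is one of value at least `M - r s * K`; on `C` this does not depend on the
value function. -/
inductive LiveReachable (T : RLTask S A) (K M : ℕ) (C : Set (S × (S → A → ℕ))) (r : S → ℕ) :
    S → Prop
  | start {s : S} : s ∈ T.start → LiveReachable T K M C r s
  | step {s s' : S} {V : S → A → ℕ} {t : S} {a : A} : LiveReachable T K M C r s → (t, V) ∈ C →
      M ≤ V s a + r s * K → T.reward s a ≠ M → s' ∈ T.tr s a → LiveReachable T K M C r s'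

lemma SlowDescent.mono {R R' : ℕ} (hRR' : R ≤ R') {s s' : S} (h : SlowDescent r R' s s') :
    SlowDescent r R s s' := by
  unfold SlowDescent at *
  omega

/-- Minimal closed sets visit every live reachable state, if the cap is not too large for it.
For the step from `s` to `s'`, a minimal closed set for the larger cap `r s + 1` is found
inside the given one; it visits `s`, with all live actions preferred, so that the given set, which
admits the descent to `s'`, visits `s'`. -/
lemma IsRanked.visits_of_liveReachable (hR : IsRanked T K M C r h) (hK : 1 ≤ K)
    (hT : ∀ s a, T.reward s a = M ∨ T.reward s a = 0) (hred : T.IsReducible M)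
    (hres : T.IsRestartable M) {x : S} (hx : LiveReachable T K M C r x) :
    r x ≤ h ∧ ∀ R ≤ r x + 1, ∀ B, IsMinClosed T K M (SlowDescent r R) C B → ∃ V, (x, V) ∈ B := by
  induction hx with
  | @start x hx =>
    refine ⟨hR.rank_le_of_mem_start hK hT hred hres hx, fun R hRx B hB => ?_⟩
    obtain ⟨s, V, a, hs, ha, hr⟩ := hR.exists_reward hB hK hT hred
      (fun s V hs a ha _ => hR.exists_slowDescent R (hB.subset hs) ha)
      (fun s s' hs' => by
        have := hR.rank_le s
        unfold SlowDescent
        omega) hx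
      (fun s hs => by
        unfold SlowDescent
        omega)
    refine ⟨_, hB.closed s V hs a ha x ?_ (Or.inl hr)⟩
    rw [hres s a hr]
    exact hx
  | @step s s' W t a _ hW hlive hr hs' ih =>
    obtain ⟨hsh, ih⟩ := ih
    have key : ∀ B, IsMinClosed T K M (SlowDescent r (r s + 1)) C B →
        ∃ V, (s, V) ∈ B ∧ a ∈ pref V s ∧ r s' < r s := by
      intro B hB
      obtain ⟨V, hV⟩ := ih _ le_rfl B hB
      have h1 := hR.mem_pref_and_rank_lt hB hK hT hsh hV
        (hR.live_of_live _ hW _ (hB.subset hV) s a hsh hlive)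
      exact ⟨V, hV, h1.1, h1.2 hr s' hs'⟩
    have hlt : r s' < r s := by
      obtain ⟨B, -, hB⟩ := (hR.closed.mono (adm' := SlowDescent r (r s + 1))
        fun _ _ _ => trivial).exists_isMinClosed hR.finite hR.nonempty subset_rfl
      obtain ⟨-, -, -, h1⟩ := key B hB
      exact h1
    refine ⟨by omega, fun R hRs B hB => ?_⟩
    obtain ⟨B', hB'B, hB'⟩ := (hB.closed.mono (adm' := SlowDescent r (r s + 1)) fun _ _ =>
      SlowDescent.mono (by omega)).exists_isMinClosed hR.finite hB.nonempty hB.subset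
    obtain ⟨V, hV, ha, -⟩ := key B' hB'
    refine ⟨_, hB.closed s V (hB'B hV) a ha s' hs' (Or.inr ?_)⟩
    unfold SlowDescent
    omega

lemma IsRanked.rank_lt_of_liveReachable (hR : IsRanked T K M C r h) (hK : 1 ≤ K)
    (hT : ∀ s a, T.reward s a = M ∨ T.reward s a = 0) (hred : T.IsReducible M)
    (hres : T.IsRestartable M) {s s' : S} (hs : LiveReachable T K M C r s) {V : S → A → ℕ} {a : A}
    (hV : (s, V) ∈ C) (ha : a ∈ pref V s) (hr : T.reward s a ≠ M) (hs' : s' ∈ T.tr s a) :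
    LiveReachable T K M C r s' ∧ r s' < r s := by
  obtain ⟨hsh, hvis⟩ := hR.visits_of_liveReachable hK hT hred hres hs
  have hlive : M ≤ V s a + r s * K := by
    have h1 : V s a = stateValue V s := ha
    rw [h1]
    exact hR.le_stateValue _ hV s hsh
  obtain ⟨B, -, hB⟩ := (hR.closed.mono (adm' := SlowDescent r (r s + 1))
    fun _ _ _ => trivial).exists_isMinClosed hR.finite hR.nonempty subset_rfl
  obtain ⟨W, hW⟩ := hvis _ le_rfl B hB
  exact ⟨.step hs hV hlive hr hs', (hR.mem_pref_and_rank_lt hB hK hT hsh hW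
    (hR.live_of_live _ hV _ (hB.subset hW) s a hsh hlive)).2 hr s' hs'⟩

lemma IsRanked.exists_mem_start (hR : IsRanked T K M C r h) (hK : 1 ≤ K)
    (hT : ∀ s a, T.reward s a = M ∨ T.reward s a = 0) (hred : T.IsReducible M)
    (hres : T.IsRestartable M) (hne : T.start.Nonempty) : ∃ c ∈ C, c.1 ∈ T.start := by
  obtain ⟨x, hx⟩ := hne
  obtain ⟨B, -, hB⟩ := (hR.closed.mono (adm' := SlowDescent r (r x + 1))
    fun _ _ _ => trivial).exists_isMinClosed hR.finite hR.nonempty subset_rfl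
  obtain ⟨V, hV⟩ := (hR.visits_of_liveReachable hK hT hred hres (.start hx)).2 _ le_rfl B hB
  exact ⟨_, hB.subset hV, hx⟩

end Ranked

/-! ### Recurrent configurations of a greedy run -/

section Runs

variable {S A : Type*} [Fintype A] [Nonempty A] {K M : ℕ} {T : RLTask S A}

/-- The configurations that occur infinitely often in a run. -/
def Run.recurrent (ρ : Run K T) : Set (S × (S → A → ℕ)) :=
  {c | ∃ᶠ i in atTop, ρ.state i = c.1 ∧ ρ.value i = c.2}

lemma Run.value_lt (ρ : Run K T) (hgreedy : ρ.IsGreedy) (hK : 1 ≤ K) (hM : 0 < M)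
    (hr : ∀ s a, T.reward s a ≤ M) (hinit : ∀ s a, ρ.value 0 s a < M) (i : ℕ) :
    ∀ s a, ρ.value i s a < M := by
  induction i with
  | zero => exact hinit
  | succ i ih =>
    rw [ρ.value_succ]
    exact updateValue_lt _ hK hM hr (hgreedy.action_mem_pref i) ih

lemma Run.stepClosed_recurrent {ρ : Run K T} (hgreedy : ρ.IsGreedy) :
    StepClosed T K M (fun _ _ => True) ρ.recurrent := by
  intro s V hs a ha s' hs' _
  have h1 := hgreedy.fair s V hs a ha s' hs'
  have h2 : ∃ᶠ i in atTop, ρ.state (i + 1) = s' ∧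
      ρ.value (i + 1) = updateValue K T V s a s' := by
    refine h1.mono fun i hi => ⟨hi.2.2.2, ?_⟩
    rw [ρ.value_succ, hi.1, hi.2.1, hi.2.2.1, hi.2.2.2]
  exact (tendsto_add_atTop_nat 1).frequently h2

lemma Run.eventually_mem_recurrent [Finite S] (ρ : Run K T) (hV : ∀ i s a, ρ.value i s a < M) :
    ∀ᶠ i in atTop, (ρ.state i, ρ.value i) ∈ ρ.recurrent := by
  classical
  have := Fintype.ofFinite S
  have hfin : (Set.univ ×ˢ Set.Icc 0 (fun _ _ => M) : Set (S × (S → A → ℕ))).Finite :=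
    Set.finite_univ.prod (Set.finite_Icc _ _)
  have hmem : ∀ i, (ρ.state i, ρ.value i) ∈
      (Set.univ ×ˢ Set.Icc 0 (fun _ _ => M) : Set (S × (S → A → ℕ))) :=
    fun i => ⟨Set.mem_univ _, fun _ _ => Nat.zero_le _, fun s a => (hV i s a).le⟩
  have hev := (hfin.subset (Set.sdiff_subset (t := ρ.recurrent))).eventually_all
    (l := atTop) (p := fun (c : S × (S → A → ℕ)) i => ¬ (ρ.state i = c.1 ∧ ρ.value i = c.2))
  have hev' := hev.2 fun c hc => not_frequently.1 hc.2
  filter_upwards [hev'] with i hi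
  by_contra hn
  exact hi _ ⟨hmem i, hn⟩ ⟨rfl, rfl⟩

/-- A property of value functions that a run preserves from some time on holds for all
recurrent configurations if it holds for one. -/
lemma Run.of_mem_recurrent {ρ : Run K T} {P : (S → A → ℕ) → Prop} {N : ℕ}
    (hP : ∀ i ≥ N, P (ρ.value i) → P (ρ.value (i + 1))) {c c' : S × (S → A → ℕ)}
    (hc : c ∈ ρ.recurrent) (hc' : c' ∈ ρ.recurrent) (h : P c.2) : P c'.2 := by
  obtain ⟨i, hi, -, hci⟩ := frequently_atTop.1 hc N
  obtain ⟨j, hj, -, hcj⟩ := frequently_atTop.1 hc' i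
  rw [← hcj]
  rw [← hci] at h
  exact Nat.le_induction h (fun k hk => hP k (hi.trans hk)) j hj

/-- The recurrent configurations of a greedy run have a rank function. -/
lemma Run.exists_isRanked [Fintype S] {ρ : Run K T} (hgreedy : ρ.IsGreedy)
    (hM : Fintype.card S * K < M) (hV : ∀ i s a, ρ.value i s a < M) :
    ∃ r h, IsRanked T K M ρ.recurrent r h := by
  have hev := ρ.eventually_mem_recurrent hV
  obtain ⟨N, hN⟩ := eventually_atTop.1 hev
  have hCM : ∀ c ∈ ρ.recurrent, ∀ t b, c.2 t b < M := fun c hc => by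
    obtain ⟨i, -, hi⟩ := Frequently.exists hc
    exact hi ▸ hV i
  have hfin : ρ.recurrent.Finite := by
    classical
    refine (Set.finite_univ.prod (Set.finite_Icc (0 : S → A → ℕ) (fun _ _ => M))).subset ?_
    exact fun c hc =>
      ⟨Set.mem_univ _, fun _ _ => Nat.zero_le _, fun s a => (hCM c hc s a).le⟩
  have hcl : StepClosed T K M (fun _ _ => True) ρ.recurrent := stepClosed_recurrent hgreedy
  let c₀ : S × (S → A → ℕ) := (ρ.state N, ρ.value N)
  have hc₀ : c₀ ∈ ρ.recurrent := hN N le_rfl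
  have hconst : ∀ c ∈ ρ.recurrent, ∀ i, learned T K M c.2 i = learned T K M c₀.2 i := by
    have hsub : ∀ c ∈ ρ.recurrent, ∀ c' ∈ ρ.recurrent, ∀ i,
        learned T K M c.2 i ⊆ learned T K M c'.2 i := fun c hc c' hc' i t ht => by
      refine of_mem_recurrent (P := fun V => t ∈ learned T K M V i) (N := 0)
        (fun j _ hj => ?_) hc hc' ht
      rw [ρ.value_succ]
      exact learned_subset_updateValue (hgreedy.action_mem_pref j) (ρ.state_succ j) (hV j) i hj
    exact fun c hc i => (hsub c hc c₀ hc₀ i).antisymm (hsub c₀ hc₀ c hc i)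
  obtain ⟨h, r, hstab, hle, hcard, hiff⟩ :=
    exists_rank (learned T K M c₀.2) (learned_subset_succ T K M c₀.2)
  have hmem : ∀ t, r t ≤ h → t ∈ learned T K M c₀.2 (r t) := fun t ht =>
    (hiff t _ ht).1 le_rfl
  have hlow : ∀ c ∈ ρ.recurrent, ∀ t, r t ≤ h → M ≤ stateValue c.2 t + r t * K :=
    fun c hc t ht => le_stateValue_of_mem_learned (hconst c hc _ ▸ hmem t ht)
  -- Membership in the layer `i + 1` bounds the rank by `i + 1`, and by `h` even for `i = h`.
  have hrank : ∀ s, ∀ i ≤ h, s ∈ learned T K M c₀.2 (i + 1) → r s ≤ i + 1 ∧ r s ≤ h := by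
    intro s i hi hs
    rcases hi.lt_or_eq with hlt | rfl
    · have := (hiff s (i + 1) hlt).2 hs
      omega
    · rw [hstab] at hs
      have := (hiff s i le_rfl).2 hs
      omega
  refine ⟨r, h, hfin, ⟨c₀, hc₀⟩, hcl, hCM, ?_, hle, ?_, ?_, ?_, hlow, ?_, ?_⟩
  · exact fun s => Nat.pos_of_ne_zero fun h0 => (hiff s 0 (Nat.zero_le _)).1 h0.le
  · exact fun s => (Nat.mul_le_mul_right K (hcard s)).trans_lt hM
  · intro s V hs a ha hr
    obtain ⟨s', hs'⟩ := T.tr_nonempty s a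
    have h1 : s ∈ learned T K M (updateValue K T V s a s') 1 := by
      refine ⟨a, ?_, Or.inl hr⟩
      rw [updateValue_reward s' ha (hCM _ hs) hr, Nat.zero_add, Nat.one_mul]
      omega
    have h2 := hrank s 0 (Nat.zero_le _)
      (hconst _ (hcl s V hs a ha s' hs' (Or.inr trivial)) 1 ▸ h1)
    refine ⟨le_antisymm h2.1 (Nat.pos_of_ne_zero fun h0 => ?_), h2.2⟩
    exact (hiff s 0 (Nat.zero_le _)).1 h0.le
  · intro s V hs a ha i hi hall
    obtain ⟨s', hs'⟩ := T.tr_nonempty s a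
    have hsub : ∀ c ∈ ρ.recurrent, T.tr s a ⊆ learned T K M c.2 i := fun c hc t ht => by
      rw [hconst c hc]
      exact (hiff t i hi).1 (hall t ht)
    have hstep := hcl s V hs a ha s' hs' (Or.inr trivial)
    have h1 : s ∈ learned T K M (updateValue K T V s a s') (i + 1) :=
      ⟨a, le_updateValue_of_mem_learned ha (hsub _ hs hs'), Or.inr (hsub _ hstep)⟩
    exact hrank s i hi (hconst _ hstep (i + 1) ▸ h1)
  · -- An action below the guaranteed value of its state is never preferred, hence never updated.
    intro c hc c' hc' t b ht hlive
    by_contra hdead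
    refine of_mem_recurrent (P := fun V => ¬ M ≤ V t b + r t * K) (N := N)
      (fun j hj hjb => ?_) hc' hc hdead hlive
    rw [ρ.value_succ, updateValue_of_ne]
    · exact hjb
    · rintro ⟨rfl, rfl⟩
      have h1 : ρ.value j (ρ.state j) (ρ.action j) = stateValue (ρ.value j) (ρ.state j) :=
        hgreedy.action_mem_pref j
      rw [h1] at hjb
      exact hjb (hlow _ (hN j hj) _ ht)
  · exact fun s hs => learned_subset_reduce T K M c₀.2 _ (hmem s hs)

end Runs

end ValueRamp

/-! ### Cycles contain reward -/

theorem theorem5 {S A : Type*} [Fintype S] [Nonempty S] [Fintype A] [Nonempty A]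
    (K M : ℕ) (hK : 1 ≤ K) (T : ValueRamp.RLTask S A)
    (hnav : T.IsNavigation K M) (hred : T.IsReducible M) (hrestart : T.IsRestartable M)
    (ρ : ValueRamp.Run K T) (hgreedy : ρ.IsGreedy)
    (hinit : ∀ s a, ρ.value 0 s a < M) :
    ∃ N : ℕ, ∀ j ≥ N, ∀ n ≥ 1, ρ.state (j + n) = ρ.state j →
      ∃ i, j ≤ i ∧ i < j + n ∧ (ρ.state i, ρ.action i) ∈ T.rewards M := by
  have hT := hnav.reward_eq
  have hV := ρ.value_lt hgreedy hK (Nat.zero_lt_of_lt hnav.large)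
    (fun s a => by rcases hT s a with h | h <;> omega) hinit
  obtain ⟨r, h, hR⟩ := ValueRamp.Run.exists_isRanked hgreedy hnav.large hV
  obtain ⟨N₀, hN₀⟩ := Filter.eventually_atTop.1 (ρ.eventually_mem_recurrent hV)
  obtain ⟨c, hc, hcs⟩ := hR.exists_mem_start hK hT hred hrestart ⟨_, ρ.state_zero⟩
  obtain ⟨N, hN, hNc, -⟩ := Filter.frequently_atTop.1 hc N₀
  have hstep : ∀ i ≥ N, ValueRamp.LiveReachable T K M ρ.recurrent r (ρ.state i) →
      T.reward (ρ.state i) (ρ.action i) ≠ M →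
      ValueRamp.LiveReachable T K M ρ.recurrent r (ρ.state (i + 1)) ∧
        r (ρ.state (i + 1)) < r (ρ.state i) := fun i hi hlr hr =>
    hR.rank_lt_of_liveReachable hK hT hred hrestart hlr (hN₀ i (hN.trans hi))
      (hgreedy.action_mem_pref i) hr (ρ.state_succ i)
  have hlive : ∀ i ≥ N, ValueRamp.LiveReachable T K M ρ.recurrent r (ρ.state i) := by
    intro i hi
    induction i, hi using Nat.le_induction with
    | base => exact .start (hNc ▸ hcs)
    | succ i hi ih =>
      by_cases hr : T.reward (ρ.state i) (ρ.action i) = M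
      · exact .start (hrestart _ _ hr ▸ ρ.state_succ i)
      · exact (hstep i hi ih hr).1
  refine ⟨N, fun j hj n hn hcyc => ?_⟩
  by_contra! hno
  have hdesc : ∀ m ≤ n, r (ρ.state (j + m)) + m ≤ r (ρ.state j) := by
    intro m
    induction m with
    | zero => exact fun _ => le_rfl
    | succ m ih =>
      intro hm
      have h1 := ih (by omega)
      have h2 := (hstep (j + m) (by omega) (hlive _ (by omega))
        (hno (j + m) (by omega) (by omega))).2
      have h3 : j + (m + 1) = j + m + 1 := rfl
      rw [h3]
      omega
  have h1 := hdesc n le_rfl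
  rw [hcyc] at h1
  omega
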